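/- Let $\mathfrak A$ be a unital $C^*$-algebra and $\mathfrak k\subset\mathfrak A$ a closed two-sided ideal. Let $G=\mathfrak A^\times$ be the (real) Banach--Lie group of invertible elements, with Lie algebra $\mathfrak A$, let $K=\mathfrak A^\times\cap(\mathbb 1+\mathfrak k)$, and let $G/K$ be the homogeneous space, a Banach manifold modelled on $\mathfrak A/\mathfrak k$ with smooth quotient map $\pi:G\to G/K$, base point $p_0=\pi(\mathbb 1)$ and action $\alpha_g(\pi(h))=\pi(gh)$. A bounded real-linear operator $N$ on $\mathfrak A$ is called admissible if $N\mathfrak k\subset\mathfrak k$ and $\operatorname{Ran}(\mathrm{Ad}_kN-N\mathrm{Ad}_k)\subset\mathfrak k$ for all $k\in K$. A smooth vector bundle map $\mathcal N:T(G/K)\to T(G/K)$ covering the identity is induced by $N$ if $\mathcal N_{p_0}\pi_{*1}v=\pi_{*1}Nv$ for $v\in\mathfrak A$ and $\mathcal N_{\alpha_g(p_0)}=(\alpha_g)_*\mathcal N_{p_0}(\alpha_g)_*^{-1}$ for $g\in G$; it is homogeneous if $(\alpha_g)_*\mathcal N_p=\mathcal N_{\alpha_g(p)}(\alpha_g)_*$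 for all $g\in G$, $p\in G/K$; and it is a Nijenhuis operator if $\mathcal N[\mathcal NX,Y]+\mathcal N[X,\mathcal NY]-[\mathcal NX,\mathcal NY]-\mathcal N^2[X,Y]=0$ for all smooth vector fields $X,Y$ on $G/K$. Let $A,B\in\mathfrak A$ and $N(a)=AaB$. Then $N$ is admissible, and it induces exactly one smooth vector bundle map $\mathcal N$ on $T(G/K)$; this $\mathcal N$ is homogeneous. Moreover: 1. If $A^2$ and $B^2$ are in the center of $\mathfrak A$ and $A^2B^2=-\mathbb 1$, then $\mathcal N^2=-1$, i.e. $\mathcal N$ is an almost complex structure. 2. If $\mathfrak A$ is commutative, then $\mathcal N$ is a Nijenhuis operator. 3. If $A=\mathbb 1$ or $B=\mathbb 1$, then $\mathcal N$ is a Nijenhuis operator. If in addition $\mathcal N^2=-1$, then $\mathcal N$ is an integrable complex structure: $G/K$ carries a structure of complex Banach manifold, with the same underlying real smooth structure, such that the differentials of its charts carry $\mathcal N$ to multiplication by $i$. -/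

import Mathlib

open scoped Manifold ContDiff

noncomputable section

universe u

/-! ### Vector bundle maps of a tangent bundle, Nijenhuis torsion, integrability -/

section BundleMaps

variable (E : Type*) [NormedAddCommGroup E] [NormedSpace ℝ E]
  (M : Type*) [TopologicalSpace M] [ChartedSpace E M] [IsManifold 𝓘(ℝ, E) ∞ M]

/-- A smooth vector bundle map `TM → TM` covering the identity of a (real, smooth) Banach manifold
`M` modelled on `E`. -/
@[ext]
structure TangentBundleMap where
  /-- The bounded operator on each fibre. -/
  toFun : ∀ p : M, TangentSpace 𝓘(ℝ, E) p →L[ℝ] TangentSpace 𝓘(ℝ, E) p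
  /-- The map of total spaces is smooth. -/
  smooth : ContMDiff 𝓘(ℝ, E).tangent 𝓘(ℝ, E).tangent ∞
    (fun x : TangentBundle 𝓘(ℝ, E) M =>
      (⟨x.1, toFun x.1 x.2⟩ : TangentBundle 𝓘(ℝ, E) M))

variable {E M}

/-- `X` is a smooth vector field on `M`. -/
def IsSmoothVectorField (X : ∀ p : M, TangentSpace 𝓘(ℝ, E) p) : Prop :=
  ContMDiff 𝓘(ℝ, E) 𝓘(ℝ, E).tangent ∞ (fun p => (⟨p, X p⟩ : TangentBundle 𝓘(ℝ, E) M))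

namespace TangentBundleMap

variable (𝒩 : TangentBundleMap E M)

/-- The vector field `𝒩 X`. -/
def onField (X : ∀ p : M, TangentSpace 𝓘(ℝ, E) p) : ∀ p : M, TangentSpace 𝓘(ℝ, E) p :=
  fun p => 𝒩.toFun p (X p)

/-- The Nijenhuis torsion
`Ω(X, Y) = 𝒩[𝒩X, Y] + 𝒩[X, 𝒩Y] - [𝒩X, 𝒩Y] - 𝒩²[X, Y]`. -/
def torsion (X Y : ∀ p : M, TangentSpace 𝓘(ℝ, E) p) (p : M) : TangentSpace 𝓘(ℝ, E) p :=
  𝒩.toFun p (VectorField.mlieBracket 𝓘(ℝ, E) (𝒩.onField X) Y p)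
    + 𝒩.toFun p (VectorField.mlieBracket 𝓘(ℝ, E) X (𝒩.onField Y) p)
    - VectorField.mlieBracket 𝓘(ℝ, E) (𝒩.onField X) (𝒩.onField Y) p
    - 𝒩.toFun p (𝒩.toFun p (VectorField.mlieBracket 𝓘(ℝ, E) X Y p))

/-- `𝒩` is a Nijenhuis operator: its torsion vanishes on all smooth vector fields. -/
def IsNijenhuis : Prop :=
  ∀ X Y : (∀ p : M, TangentSpace 𝓘(ℝ, E) p), IsSmoothVectorField X → IsSmoothVectorField Y →
    ∀ p, 𝒩.torsion X Y p = 0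

/-- `𝒩² = -1`, i.e. `𝒩` is an almost complex structure. -/
def IsAlmostComplex : Prop :=
  ∀ (p : M) (v : TangentSpace 𝓘(ℝ, E) p), 𝒩.toFun p (𝒩.toFun p v) = -v

end TangentBundleMap

/-- `𝒥` is an integrable complex structure on `M`: it squares to `-1`, and `M` carries a structure
of complex Banach manifold (an atlas on the topological space `M` with charts in a complex Banach
space `F` and holomorphic transition maps) compatible with `𝒥`, i.e. its charts are diffeomorphisms
for the given real smooth structure and their differentials carry `𝒥` to multiplication
by `i`. -/
def TangentBundleMap.IsIntegrableComplexStructure {E : Type u} [NormedAddCommGroup E]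
    [NormedSpace ℝ E] {M : Type*} [TopologicalSpace M] [ChartedSpace E M]
    [IsManifold 𝓘(ℝ, E) ∞ M] (𝒥 : TangentBundleMap E M) : Prop :=
  𝒥.IsAlmostComplex ∧
  ∃ (F : Type u) (_ : NormedAddCommGroup F) (_ : NormedSpace ℂ F) (_ : CompleteSpace F)
    (cplx : ChartedSpace F M),
    IsManifold 𝓘(ℂ, F) ω M ∧
    ∀ e ∈ cplx.atlas,
      ContMDiffOn 𝓘(ℝ, E) 𝓘(ℝ, F) ∞ e e.source ∧
      ContMDiffOn 𝓘(ℝ, F) 𝓘(ℝ, E) ∞ e.symm e.target ∧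
      ∀ p ∈ e.source, ∃ d : E →L[ℝ] F, HasMFDerivAt 𝓘(ℝ, E) 𝓘(ℝ, F) e p d ∧
        ∀ v : TangentSpace 𝓘(ℝ, E) p, d (𝒥.toFun p v) = Complex.I • d v

end BundleMaps

/-! ### Homogeneous spaces, homogeneous bundle maps and admissible operators -/

section Homogeneous

variable {E : Type*} [NormedAddCommGroup E] [NormedSpace ℝ E]
  {G : Type*} [TopologicalSpace G] [ChartedSpace E G] [Group G]
  (K : Subgroup G)

/-- The adjoint action `Ad_g` on the Lie algebra `T_1 G`: the differential at `1` of the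
conjugation by `g`. -/
def lieAd (g : G) : GroupLieAlgebra 𝓘(ℝ, E) G → GroupLieAlgebra 𝓘(ℝ, E) G := fun v =>
  let d : E →L[ℝ] E := mfderiv 𝓘(ℝ, E) 𝓘(ℝ, E) (fun h : G => g * h * g⁻¹) 1
  d v

/-- `N` is an admissible operator for `K`, where `𝔨` is the Lie algebra of `K`:
`N 𝔨 ⊆ 𝔨` and `Ran (Ad_k N - N Ad_k) ⊆ 𝔨` for every `k ∈ K`. -/
def IsAdmissible (𝔨 : Submodule ℝ (GroupLieAlgebra 𝓘(ℝ, E) G))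
    (N : GroupLieAlgebra 𝓘(ℝ, E) G →L[ℝ] GroupLieAlgebra 𝓘(ℝ, E) G) : Prop :=
  (∀ v ∈ 𝔨, N v ∈ 𝔨) ∧ ∀ k ∈ K, ∀ v, lieAd k (N v) - N (lieAd k v) ∈ 𝔨

variable (E' : Type*) [NormedAddCommGroup E'] [NormedSpace ℝ E'] [ChartedSpace E' (G ⧸ K)]

/-- `G ⧸ K`, with the quotient topology and the given atlas, is a homogeneous space of `G`:
a Hausdorff smooth manifold such that the quotient map `G → G ⧸ K` is a smooth map with
surjective differentials. -/
structure IsHomogeneousSpace : Prop where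
  t2 : T2Space (G ⧸ K)
  isManifold : IsManifold 𝓘(ℝ, E') ∞ (G ⧸ K)
  contMDiff_mk : ContMDiff 𝓘(ℝ, E) 𝓘(ℝ, E') ∞ (fun g : G => (g : G ⧸ K))
  surjective_mfderiv : ∀ g : G,
    Function.Surjective (mfderiv 𝓘(ℝ, E) 𝓘(ℝ, E') (fun g : G => (g : G ⧸ K)) g)

variable {K E'} [IsManifold 𝓘(ℝ, E') ∞ (G ⧸ K)]

namespace TangentBundleMap

/-- `𝒩` is homogeneous: `(α_g)_* 𝒩_p = 𝒩_{α_g(p)} (α_g)_*`, where `α_g (p) = g • p`. -/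
def IsHomogeneous (𝒩 : TangentBundleMap E' (G ⧸ K)) : Prop :=
  ∀ (g : G) (p : G ⧸ K) (v : TangentSpace 𝓘(ℝ, E') p),
    mfderiv 𝓘(ℝ, E') 𝓘(ℝ, E') (fun q : G ⧸ K => g • q) p (𝒩.toFun p v)
      = 𝒩.toFun (g • p) (mfderiv 𝓘(ℝ, E') 𝓘(ℝ, E') (fun q : G ⧸ K => g • q) p v)

/-- `𝒩` is the bundle map induced by `N`: at the base point `p₀ = π(1)` one has
`𝒩_{p₀} π_{*1} v = π_{*1} N v`, and `𝒩_{g p₀} = (α_g)_* 𝒩_{p₀} (α_g)_*⁻¹` for every `g`. -/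
def IsInducedBy (𝒩 : TangentBundleMap E' (G ⧸ K))
    (N : GroupLieAlgebra 𝓘(ℝ, E) G →L[ℝ] GroupLieAlgebra 𝓘(ℝ, E) G) : Prop :=
  (∀ v : GroupLieAlgebra 𝓘(ℝ, E) G,
    𝒩.toFun ((1 : G) : G ⧸ K) (mfderiv 𝓘(ℝ, E) 𝓘(ℝ, E') (fun g : G => (g : G ⧸ K)) 1 v)
      = mfderiv 𝓘(ℝ, E) 𝓘(ℝ, E') (fun g : G => (g : G ⧸ K)) 1 (N v)) ∧
  ∀ (g : G) (w : TangentSpace 𝓘(ℝ, E') ((1 : G) : G ⧸ K)),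
    𝒩.toFun (g • ((1 : G) : G ⧸ K))
        (mfderiv 𝓘(ℝ, E') 𝓘(ℝ, E') (fun q : G ⧸ K => g • q) ((1 : G) : G ⧸ K) w)
      = mfderiv 𝓘(ℝ, E') 𝓘(ℝ, E') (fun q : G ⧸ K => g • q) ((1 : G) : G ⧸ K)
          (𝒩.toFun ((1 : G) : G ⧸ K) w)

end TangentBundleMap

end Homogeneous

/-! ### The homogeneous space attached to a closed two-sided ideal of a C*-algebra -/

section CStar

variable {𝔄 : Type u} [CStarAlgebra 𝔄] (𝔨 : Ideal 𝔄)

/-- The subgroup `K = 𝔄ˣ ∩ (1 + 𝔨)` of the group `G = 𝔄ˣ`. -/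
def onePlusUnits : Subgroup 𝔄ˣ where
  carrier := {g | (g : 𝔄) - 1 ∈ 𝔨}
  one_mem' := by simp
  mul_mem' := by
    intro a b ha hb
    have h : ((a * b : 𝔄ˣ) : 𝔄) - 1 = a * ((b : 𝔄) - 1) + ((a : 𝔄) - 1) := by
      push_cast; noncomm_ring
    show ((a * b : 𝔄ˣ) : 𝔄) - 1 ∈ 𝔨
    rw [h]
    exact add_mem (𝔨.mul_mem_left _ hb) ha
  inv_mem' := by
    intro a ha
    have h : ((a⁻¹ : 𝔄ˣ) : 𝔄) - 1 = (-(a⁻¹ : 𝔄ˣ) : 𝔄) * ((a : 𝔄) - 1) := by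
      rw [neg_mul, mul_sub, Units.inv_mul, mul_one, neg_sub]
    show ((a⁻¹ : 𝔄ˣ) : 𝔄) - 1 ∈ 𝔨
    rw [h]
    exact 𝔨.mul_mem_left _ ha

/-- The ideal `𝔨`, viewed as a real subspace of the Lie algebra `T_1 𝔄ˣ = 𝔄`. -/
def idealLie : Submodule ℝ (GroupLieAlgebra 𝓘(ℝ, 𝔄) 𝔄ˣ) :=
  (𝔨.restrictScalars ℝ : Submodule ℝ 𝔄)

/-- The operator `N(a) = A a B` on the Lie algebra `T_1 𝔄ˣ = 𝔄`. -/
def leftRightMul (A B : 𝔄) :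
    GroupLieAlgebra 𝓘(ℝ, 𝔄) 𝔄ˣ →L[ℝ] GroupLieAlgebra 𝓘(ℝ, 𝔄) 𝔄ˣ :=
  (ContinuousLinearMap.mulLeftRight ℝ 𝔄 A B : 𝔄 →L[ℝ] 𝔄)

theorem leftRightMul_apply (A B a : 𝔄) : leftRightMul A B a = A * a * B := rfl

theorem mk_eq_mk_iff (a b : 𝔄ˣ) :
    (a : 𝔄ˣ ⧸ onePlusUnits 𝔨) = b ↔ Submodule.Quotient.mk (p := 𝔨) (a : 𝔄)
      = Submodule.Quotient.mk (b : 𝔄) := by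
  rw [QuotientGroup.eq, eq_comm, Submodule.Quotient.eq]
  have h : (b : 𝔄) - a = a * (((a⁻¹ * b : 𝔄ˣ) : 𝔄) - 1) := by
    rw [mul_sub, Units.val_mul, Units.mul_inv_cancel_left, mul_one]
  have h' : (((a⁻¹ * b : 𝔄ˣ) : 𝔄) - 1) = (a⁻¹ : 𝔄ˣ) * ((b : 𝔄) - a) := by
    rw [mul_sub, Units.val_mul, Units.inv_mul]
  constructor
  · intro hk
    rw [h]
    exact 𝔨.mul_mem_left _ hk
  · intro hk
    show (((a⁻¹ * b : 𝔄ˣ) : 𝔄) - 1) ∈ 𝔨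
    rw [h']
    exact 𝔨.mul_mem_left _ hk

/-- The injection `G ⧸ K → 𝔄 ⧸ 𝔨`, `g K ↦ g + 𝔨`. -/
def quotientEmbedding : 𝔄ˣ ⧸ onePlusUnits 𝔨 → 𝔄 ⧸ 𝔨 :=
  Quotient.lift (fun g : 𝔄ˣ => Submodule.Quotient.mk (p := 𝔨) (g : 𝔄))
    (fun a b hab => (mk_eq_mk_iff 𝔨 a b).1 (Quotient.sound hab))

theorem quotientEmbedding_mk (g : 𝔄ˣ) :
    quotientEmbedding 𝔨 (g : 𝔄ˣ ⧸ onePlusUnits 𝔨) = Submodule.Quotient.mk (g : 𝔄) := rfl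

theorem isOpenEmbedding_quotientEmbedding :
    Topology.IsOpenEmbedding (quotientEmbedding 𝔨) := by
  refine Topology.IsOpenEmbedding.of_continuous_injective_isOpenMap ?_ ?_ ?_
  · refine continuous_quot_lift _ ?_
    exact (continuous_quot_mk : Continuous (Submodule.Quotient.mk (p := 𝔨))).comp
      Units.continuous_val
  · intro x y
    induction x using QuotientGroup.induction_on with | _ a
    induction y using QuotientGroup.induction_on with | _ b
    exact (mk_eq_mk_iff 𝔨 a b).2
  · intro U hU
    have h : quotientEmbedding 𝔨 '' U = (Submodule.Quotient.mk (p := 𝔨)) ''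
        (Units.val '' ((fun g : 𝔄ˣ => (g : 𝔄ˣ ⧸ onePlusUnits 𝔨)) ⁻¹' U)) := by
      ext x
      constructor
      · rintro ⟨y, hy, rfl⟩
        induction y using QuotientGroup.induction_on with | _ a
        exact ⟨a, ⟨a, hy, rfl⟩, rfl⟩
      · rintro ⟨_, ⟨a, ha, rfl⟩, rfl⟩
        exact ⟨a, ha, rfl⟩
    rw [h]
    exact (𝔨.isOpenMap_mkQ) _
      (Units.isOpenEmbedding_val.isOpenMap _ (hU.preimage continuous_quot_mk))

variable [IsClosed (𝔨 : Set 𝔄)]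

/-- The manifold structure of `G ⧸ K`, modelled on `𝔄 ⧸ 𝔨`: its single global chart is the open
embedding `g K ↦ g + 𝔨`. -/
instance instChartedSpaceQuotient : ChartedSpace (𝔄 ⧸ 𝔨) (𝔄ˣ ⧸ onePlusUnits 𝔨) :=
  (isOpenEmbedding_quotientEmbedding 𝔨).singletonChartedSpace

instance instIsManifoldQuotient : IsManifold 𝓘(ℝ, 𝔄 ⧸ 𝔨) ∞ (𝔄ˣ ⧸ onePlusUnits 𝔨) :=
  (isOpenEmbedding_quotientEmbedding 𝔨).isManifold_singleton

/-- The quotient map `Q : 𝔄 → 𝔄 ⧸ 𝔨`. -/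
def idealMkL : 𝔄 →L[ℝ] 𝔄 ⧸ 𝔨 :=
  ⟨(𝔨.mkQ).restrictScalars ℝ, continuous_quot_mk⟩

theorem contMDiff_unitsMk :
    ContMDiff 𝓘(ℝ, 𝔄) 𝓘(ℝ, 𝔄 ⧸ 𝔨) ∞ (fun g : 𝔄ˣ => (g : 𝔄ˣ ⧸ onePlusUnits 𝔨)) := by
  apply ContMDiff.of_comp_isOpenEmbedding (isOpenEmbedding_quotientEmbedding 𝔨)
  exact (idealMkL 𝔨).contMDiff.comp Units.contMDiff_val

theorem hasMFDerivAt_mk (g : 𝔄ˣ) :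
    HasMFDerivAt 𝓘(ℝ, 𝔄) 𝓘(ℝ, 𝔄 ⧸ 𝔨) (fun g : 𝔄ˣ => (g : 𝔄ˣ ⧸ onePlusUnits 𝔨)) g
      (idealMkL 𝔨) := by
  refine ⟨(contMDiff_unitsMk 𝔨).continuous.continuousAt, ?_⟩
  refine (HasFDerivAt.congr_of_eventuallyEq (idealMkL 𝔨).hasFDerivAt ?_).hasFDerivWithinAt
  have h : Set.range (Units.val : 𝔄ˣ → 𝔄) ∈ nhds (g : 𝔄) :=
    Units.isOpenEmbedding_val.isOpen_range.mem_nhds ⟨g, rfl⟩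
  filter_upwards [h]
  rintro _ ⟨a, rfl⟩
  have h2 : (chartAt 𝔄 g).symm (a : 𝔄) = a :=
    (chartAt 𝔄 g).left_inv (Set.mem_univ a)
  show quotientEmbedding 𝔨 (((chartAt 𝔄 g).symm (a : 𝔄) : 𝔄ˣ) : 𝔄ˣ ⧸ onePlusUnits 𝔨) = _
  rw [h2]
  rfl

/-- The kernel of the differential at `1` of the quotient map, i.e. the Lie algebra of `K`,
is `𝔨`. -/
theorem mfderiv_mk_eq_zero_iff (v : GroupLieAlgebra 𝓘(ℝ, 𝔄) 𝔄ˣ) :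
    mfderiv 𝓘(ℝ, 𝔄) 𝓘(ℝ, 𝔄 ⧸ 𝔨) (fun g : 𝔄ˣ => (g : 𝔄ˣ ⧸ onePlusUnits 𝔨)) 1 v = 0
      ↔ v ∈ idealLie 𝔨 := by
  rw [(hasMFDerivAt_mk 𝔨 1).mfderiv]
  exact Submodule.Quotient.mk_eq_zero 𝔨

theorem isHomogeneousSpace_onePlusUnits :
    IsHomogeneousSpace (E := 𝔄) (onePlusUnits 𝔨) (𝔄 ⧸ 𝔨) where
  t2 := (isOpenEmbedding_quotientEmbedding 𝔨).isEmbedding.t2Space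
  isManifold := inferInstance
  contMDiff_mk := contMDiff_unitsMk 𝔨
  surjective_mfderiv g := by
    rw [(hasMFDerivAt_mk 𝔨 g).mfderiv]
    exact Submodule.Quotient.mk_surjective 𝔨

end CStar

end

noncomputable section

/-! ### Manifolds with a single chart -/

section SingleChart

variable {E : Type*} [NormedAddCommGroup E] [NormedSpace ℝ E]
  {M : Type*} [TopologicalSpace M] [ChartedSpace E M]
  {e : OpenPartialHomeomorph M E}

/-! The map `gK ↦ g + 𝔨` is a global chart of `G/K` whose image consists of units of the Banach
algebra `𝔄/𝔨`. In it the action of `g` is left multiplication by the class of `g`, hence its own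
differential. Writing `a`, `b` for the classes of `A`, `B`, a bundle map is induced by `N` iff its
operator at `x` is `w ↦ x a x⁻¹ w b` (`isInducedBy_leftRightMul_iff`). Existence, uniqueness and
homogeneity follow, and the other claims become computations in `𝔄/𝔨`.

If `a²` is central and `a²b² = -1`, the square of this operator is `w ↦ x a² x⁻¹ w b² = -w`. If `a =
1` or the algebra is commutative, the operator does not depend on `x`, so its torsion vanishes. If
`b = 1`, differentiating the coefficient in direction `𝒩v` is `𝒩` times differentiating it in
direction `v`, which again makes the torsion vanish (`conjMul_torsion_eq_zero`).

For integrability, a chart making `𝒩` a constant `J` suffices: the given chart when `a = 1`, and its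
composite with `x ↦ x⁻¹` when `b = 1`. Then `J² = -1` turns the model into a complex Banach space
after an equivalent renorming (`exists_complex_equiv`). -/

theorem hasMFDerivAt_of_chartAt_eq {E' : Type*} [NormedAddCommGroup E'] [NormedSpace ℝ E']
    {M' : Type*} [TopologicalSpace M'] [ChartedSpace E' M'] {e' : OpenPartialHomeomorph M' E'}
    (he : ∀ x, chartAt E x = e) (he' : ∀ x, chartAt E' x = e')
    {f : M → M'} {x : M} {d : E →L[ℝ] E'} (hf : ContinuousAt f x)
    (h : HasFDerivAt (fun y => e' (f (e.symm y))) d (e x)) :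
    HasMFDerivAt 𝓘(ℝ, E) 𝓘(ℝ, E') f x d := by
  refine ⟨hf, ?_⟩
  simp only [writtenInExtChartAt, extChartAt, he, he', mfld_simps]
  exact h.hasFDerivWithinAt

/-- Each tangent space is a copy of `E` identified through the preferred chart, so that chart
differentiates to the identity. -/
theorem hasMFDerivAt_singleChart (he : ∀ x, chartAt E x = e) (hs : e.source = Set.univ) (x : M) :
    HasMFDerivAt 𝓘(ℝ, E) 𝓘(ℝ, E) e x (ContinuousLinearMap.id ℝ E) := by
  have hx : x ∈ e.source := hs ▸ Set.mem_univ x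
  refine hasMFDerivAt_of_chartAt_eq (e' := OpenPartialHomeomorph.refl E) he (fun _ => rfl)
    (e.continuousAt hx) ?_
  refine (hasFDerivAt_id _).congr_of_eventuallyEq ?_
  filter_upwards [e.open_target.mem_nhds (e.map_source hx)] with y hy
  exact e.right_inv hy

theorem hasMFDerivAt_singleChart_symm (he : ∀ x, chartAt E x = e) {y : E} (hy : y ∈ e.target) :
    HasMFDerivAt 𝓘(ℝ, E) 𝓘(ℝ, E) e.symm y (ContinuousLinearMap.id ℝ E) := by
  refine hasMFDerivAt_of_chartAt_eq (e := OpenPartialHomeomorph.refl E) (fun _ => rfl) he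
    (e.symm.continuousAt hy) ?_
  refine (hasFDerivAt_id _).congr_of_eventuallyEq ?_
  filter_upwards [e.open_target.mem_nhds hy] with y hy
  exact e.right_inv hy

/-- The vector field `X` in the coordinates of the chart `e`. -/
def vectorFieldCoord (e : OpenPartialHomeomorph M E) (X : ∀ p : M, TangentSpace 𝓘(ℝ, E) p) :
    E → E := fun y => X (e.symm y)

/-- The manifold bracket is computed after pulling both fields back along the chart, and here those
pullbacks have identity differential. They match the coordinate fields only near `e p`, which
suffices because the bracket depends on germs. -/
theorem mlieBracket_singleChart [IsManifold 𝓘(ℝ, E) ∞ M] (he : ∀ x, chartAt E x = e)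
    (hs : e.source = Set.univ) (X Y : ∀ p : M, TangentSpace 𝓘(ℝ, E) p) (p : M) :
    VectorField.mlieBracket 𝓘(ℝ, E) X Y p =
      VectorField.lieBracket ℝ (vectorFieldCoord e X) (vectorFieldCoord e Y) (e p) := by
  have hp : p ∈ e.source := hs ▸ Set.mem_univ p
  have key : ∀ Z : (∀ p : M, TangentSpace 𝓘(ℝ, E) p),
      VectorField.mpullbackWithin 𝓘(ℝ, E) 𝓘(ℝ, E) e.symm Z Set.univ
        =ᶠ[nhds (e p)] vectorFieldCoord e Z := by
    intro Z
    filter_upwards [e.open_target.mem_nhds (e.map_source hp)] with y hy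
    rw [VectorField.mpullbackWithin_apply, mfderivWithin_univ,
      (hasMFDerivAt_singleChart_symm he hy).mfderiv]
    erw [ContinuousLinearMap.inverse_id]
    rfl
  have hd := (hasMFDerivAt_singleChart he hs p).mfderiv
  have hep := he p
  subst hep
  rw [← VectorField.mlieBracketWithin_univ, VectorField.mlieBracketWithin_apply]
  have aux : ∀ {V W V' W' : E → E} {s : Set E} {x : E}, s = Set.univ → V =ᶠ[nhds x] V' →
      W =ᶠ[nhds x] W' →
      VectorField.lieBracketWithin ℝ V W s x = VectorField.lieBracket ℝ V' W' x := by
    rintro V W V' W' _ x rfl hV hW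
    rw [VectorField.lieBracketWithin_univ, hV.lieBracket_vectorField_eq hW]
  have hset : (extChartAt 𝓘(ℝ, E) p).symm ⁻¹' Set.univ ∩ Set.range 𝓘(ℝ, E) = Set.univ := by
    simp
  have hrange : Set.range 𝓘(ℝ, E) = Set.univ := by simp
  rw [hrange] at hset ⊢
  refine Eq.trans (congrArg (mfderiv 𝓘(ℝ, E) 𝓘(ℝ, E) (chartAt E p) p).inverse
    (aux hset (key X) (key Y))) ?_
  rw [hd]
  erw [ContinuousLinearMap.inverse_id]
  rfl

/-- The coordinate change from a chart to itself is the identity; smoothness of sections and bundle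
maps thus reduces to that of `E`-valued maps. -/
theorem trivializationAt_singleChart_snd [IsManifold 𝓘(ℝ, E) ∞ M] (he : ∀ x, chartAt E x = e)
    (p : M) (z : TangentBundle 𝓘(ℝ, E) M) :
    (trivializationAt E (TangentSpace 𝓘(ℝ, E)) p z).2 = z.2 := by
  have h : achart E z.1 = achart E p := Subtype.ext ((he z.1).trans (he p).symm)
  change (tangentBundleCore 𝓘(ℝ, E) M).coordChange (achart E z.1) (achart E p) z.1 z.2 = z.2
  rw [← h]
  exact (tangentBundleCore 𝓘(ℝ, E) M).coordChange_self _ _ (mem_chart_source E z.1) _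

theorem contMDiffOn_singleChart_symm [IsManifold 𝓘(ℝ, E) ∞ M] (he : ∀ x, chartAt E x = e) :
    ContMDiffOn 𝓘(ℝ, E) 𝓘(ℝ, E) ∞ e.symm e.target := by
  rcases isEmpty_or_nonempty M with hM | ⟨⟨p⟩⟩
  · exact fun y _ => isEmptyElim (e.symm y)
  · exact he p ▸ contMDiffOn_chart_symm

theorem contMDiff_singleChart [IsManifold 𝓘(ℝ, E) ∞ M] (he : ∀ x, chartAt E x = e)
    (hs : e.source = Set.univ) : ContMDiff 𝓘(ℝ, E) 𝓘(ℝ, E) ∞ e := by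
  intro p
  have h : ContMDiffOn 𝓘(ℝ, E) 𝓘(ℝ, E) ∞ e e.source := he p ▸ contMDiffOn_chart
  exact h.contMDiffAt (e.open_source.mem_nhds (hs ▸ Set.mem_univ p))

theorem IsSmoothVectorField.contDiffOn_singleChart [IsManifold 𝓘(ℝ, E) ∞ M]
    (he : ∀ x, chartAt E x = e)
    {X : ∀ p : M, TangentSpace 𝓘(ℝ, E) p} (hX : IsSmoothVectorField X) :
    ContDiffOn ℝ ∞ (vectorFieldCoord e X) e.target := by
  rw [← contMDiffOn_iff_contDiffOn]
  have h : ContMDiff 𝓘(ℝ, E) 𝓘(ℝ, E) ∞ (fun p => (X p : E)) := by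
    intro p
    have h := (Bundle.contMDiffAt_totalSpace.1 (hX p)).2
    simp only [trivializationAt_singleChart_snd he] at h
    exact h
  exact h.comp_contMDiffOn (contMDiffOn_singleChart_symm he)

/-- A smooth family of operators, in the coordinates of a global chart, is a smooth bundle map. -/
def TangentBundleMap.ofSingleChart [IsManifold 𝓘(ℝ, E) ∞ M]
    (he : ∀ x, chartAt E x = e) (hs : e.source = Set.univ)
    (T : E → E →L[ℝ] E) (hT : ContDiffOn ℝ ∞ T e.target) : TangentBundleMap E M where
  toFun p := T (e p)
  smooth := by
    intro z
    have hproj : ContMDiffAt 𝓘(ℝ, E).tangent 𝓘(ℝ, E) ∞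
        (fun x : TangentBundle 𝓘(ℝ, E) M => x.1) z :=
      Bundle.contMDiffAt_proj (TangentSpace 𝓘(ℝ, E))
    refine Bundle.contMDiffAt_totalSpace.2 ⟨hproj, ?_⟩
    simp only [trivializationAt_singleChart_snd he]
    have hsnd : ContMDiffAt 𝓘(ℝ, E).tangent 𝓘(ℝ, E) ∞
        (fun x : TangentBundle 𝓘(ℝ, E) M => (x.2 : E)) z := by
      have h := (Bundle.contMDiffAt_totalSpace.1
        (contMDiffAt_id (I := 𝓘(ℝ, E).tangent) (n := ∞) (x := z))).2
      simp only [trivializationAt_singleChart_snd he] at h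
      exact h
    have hTe : ContMDiffAt 𝓘(ℝ, E).tangent 𝓘(ℝ, E →L[ℝ] E) ∞
        (fun x : TangentBundle 𝓘(ℝ, E) M => T (e x.1)) z := by
      have hz : e z.1 ∈ e.target := e.map_source (hs ▸ Set.mem_univ _)
      exact ((hT.contDiffAt (e.open_target.mem_nhds hz)).contMDiffAt).comp z
        (((contMDiff_singleChart he hs) z.1).comp z hproj)
    exact hTe.clm_apply hsnd

end SingleChart

/-! ### The field of operators `w ↦ x a x⁻¹ w b` on a Banach algebra -/

section Conj

variable {R : Type*} [NormedRing R] [NormedAlgebra ℝ R]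

/-- The operator `w ↦ x a x⁻¹ w b`. -/
def conjMul (a b x : R) : R →L[ℝ] R :=
  ContinuousLinearMap.mulLeftRight ℝ R (x * a * Ring.inverse x) b

theorem conjMul_apply (a b x w : R) : conjMul a b x w = x * a * Ring.inverse x * w * b := rfl

theorem conjMul_one_apply (a b w : R) : conjMul a b 1 w = a * w * b := by
  simp [conjMul_apply]

theorem conjMul_one_left (b : R) (x : Rˣ) : conjMul 1 b (x : R) = conjMul 1 b 1 := by
  ext w
  simp [conjMul_apply]

/-- Since inversion has differential `w ↦ -x⁻¹ w x⁻¹`, this says that inversion carries the field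
with `b = 1` to a constant one. -/
theorem inv_mul_conjMul_mul_inv (a : R) (x : Rˣ) (w : R) :
    ↑x⁻¹ * conjMul a 1 (x : R) w * ↑x⁻¹ = conjMul a 1 1 (↑x⁻¹ * w * ↑x⁻¹) := by
  simp [conjMul_apply, mul_assoc]

/-- Invariance under left translations: it yields homogeneity and determines the field from its
value at `1`. -/
theorem conjMul_units_mul_apply (a b : R) (g x : Rˣ) (w : R) :
    conjMul a b (g * x) (g * w) = g * conjMul a b x w := by
  rw [← Units.val_mul, conjMul_apply, conjMul_apply, Ring.inverse_unit, Ring.inverse_unit]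
  simp [mul_assoc]

variable [CompleteSpace R]

theorem contDiffAt_conjMul (a b : R) (x : Rˣ) : ContDiffAt ℝ ∞ (conjMul a b) (x : R) := by
  have h : ContDiffAt ℝ ∞ (fun y : R => y * a * Ring.inverse y) (x : R) :=
    (contDiffAt_id.mul contDiffAt_const).mul (contDiffAt_ringInverse ℝ x)
  exact (((ContinuousLinearMap.mulLeftRight ℝ R).contDiff.contDiffAt).comp _ h).clm_apply
    contDiffAt_const

theorem hasFDerivAt_conjMul_apply (a b : R) (x : Rˣ) {X : R → R} {X' : R →L[ℝ] R}
    (hX : HasFDerivAt X X' (x : R)) :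
    ∃ D : R →L[ℝ] R, HasFDerivAt (fun y => conjMul a b y (X y)) D (x : R) ∧
      ∀ v, D v = (v * a * ↑x⁻¹ - x * a * ↑x⁻¹ * v * ↑x⁻¹) * X x * b
        + x * a * ↑x⁻¹ * X' v * b := by
  have h := ((((hasFDerivAt_id (𝕜 := ℝ) (x : R)).mul_const' a).mul'
    (hasFDerivAt_ringInverse x)).mul' hX).mul_const' b
  refine ⟨_, h, fun v => ?_⟩
  simp
  noncomm_ring

/-- The Nijenhuis torsion of `x ↦ (w ↦ x a x⁻¹ w b)` vanishes if `a` or `b` is trivial or the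
algebra is commutative. -/
theorem conjMul_torsion_eq_zero (a b : R) (h : a = 1 ∨ b = 1 ∨ ∀ x y : R, x * y = y * x) (x : Rˣ)
    {X Y : R → R} (hX : DifferentiableAt ℝ X x) (hY : DifferentiableAt ℝ Y x) :
    conjMul a b x (VectorField.lieBracket ℝ (fun y => conjMul a b y (X y)) Y x)
      + conjMul a b x (VectorField.lieBracket ℝ X (fun y => conjMul a b y (Y y)) x)
      - VectorField.lieBracket ℝ (fun y => conjMul a b y (X y)) (fun y => conjMul a b y (Y y)) x
      - conjMul a b x (conjMul a b x (VectorField.lieBracket ℝ X Y x)) = 0 := by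
  obtain ⟨DX, hDX, hDX'⟩ := hasFDerivAt_conjMul_apply a b x hX.hasFDerivAt
  obtain ⟨DY, hDY, hDY'⟩ := hasFDerivAt_conjMul_apply a b x hY.hasFDerivAt
  simp only [VectorField.lieBracket, hDX.fderiv, hDY.fderiv, hDX', hDY']
  simp only [conjMul_apply, Ring.inverse_unit]
  -- The terms containing `X'` and `Y'` cancel for arbitrary linear maps; only derivatives of the
  -- coefficient `x a x⁻¹` remain to be compared.
  generalize fderiv ℝ X x = X'
  generalize fderiv ℝ Y x = Y'
  rcases h with rfl | rfl | h
  · simp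
    noncomm_ring
  · simp
    have e : ∀ z : R, (↑x⁻¹ : R) * (x * z) = z := fun z => Units.inv_mul_cancel_left x z
    simp only [sub_mul, mul_sub, mul_assoc, e, mul_add]
    abel
  · have e : ∀ z : R, (x : R) * z * ↑x⁻¹ = z := fun z => by
      rw [h (x : R), Units.mul_inv_cancel_right]
    -- In the commutative case `x a x⁻¹ = a`, and this is its vanishing derivative.
    have e' : ∀ v : R, v * a * (↑x⁻¹ : R) - a * v * ↑x⁻¹ = 0 := fun v => by
      rw [h v, sub_self]
    simp only [e, e', zero_mul, zero_add, mul_sub, sub_mul]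
    abel

end Conj

/-! ### Complex structures on real Banach spaces -/

section Complexify

variable {E : Type u} [NormedAddCommGroup E] [NormedSpace ℝ E]

/-- The map `v ↦ (z ↦ Re z • v + Im z • J v)`. -/
def complexOrbit (J : E →L[ℝ] E) : E →L[ℝ] (ℂ →L[ℝ] E) :=
  ContinuousLinearMap.smulRightL ℝ ℂ E Complex.reCLM +
    (ContinuousLinearMap.smulRightL ℝ ℂ E Complex.imCLM).comp J

theorem complexOrbit_apply (J : E →L[ℝ] E) (v : E) (z : ℂ) :
    complexOrbit J v z = z.re • v + z.im • J v := by
  simp [complexOrbit]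

/-- The space `E`, regarded as a complex vector space in which `i` acts as `J`. -/
def ComplexSpace (J : E →L[ℝ] E) (_ : ∀ v, J (J v) = -v) : Type u := E

namespace ComplexSpace

variable (J : E →L[ℝ] E) (hJ : ∀ v, J (J v) = -v)

instance : AddCommGroup (ComplexSpace J hJ) := inferInstanceAs (AddCommGroup E)

/-- The algebra homomorphism `ℂ → End E` with `i ↦ J`. -/
def action : ℂ →ₐ[ℝ] Module.End ℝ E :=
  Complex.lift ⟨(J : E →ₗ[ℝ] E), by ext v; simpa using hJ v⟩

theorem action_apply (z : ℂ) (v : E) : action J hJ z v = z.re • v + z.im • J v := by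
  simp [action, Complex.liftAux_apply]

instance : Module ℂ (ComplexSpace J hJ) :=
  Module.compHom E (action J hJ).toRingHom

theorem smul_def (z : ℂ) (v : ComplexSpace J hJ) : z • v = (action J hJ z (v : E) : E) := rfl

/-- The identity, as a map into the complex vector space. -/
def ofReal : E →+ ComplexSpace J hJ := AddMonoidHom.id E

/-- The embedding `complexOrbit`, which induces the norm. -/
def orbit : ComplexSpace J hJ →+ (ℂ →L[ℝ] E) :=
  (complexOrbit J : E →ₗ[ℝ] (ℂ →L[ℝ] E)).toAddMonoidHom

theorem orbit_injective : Function.Injective (orbit J hJ) := by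
  intro v w h
  have h1 : complexOrbit J (v : E) 1 = complexOrbit J (w : E) 1 := DFunLike.congr_fun h (1 : ℂ)
  have key : ∀ v : E, complexOrbit J v 1 = v := by simp [complexOrbit_apply]
  exact (key v).symm.trans (h1.trans (key w))

/-- The norm of `E` need not be compatible with complex scalars. The operator norm of `z ↦ z • v`
is, and it is equivalent to the original one. -/
instance : NormedAddCommGroup (ComplexSpace J hJ) :=
  NormedAddCommGroup.induced _ (ℂ →L[ℝ] E) (orbit J hJ) (orbit_injective J hJ)

theorem norm_def (v : ComplexSpace J hJ) : ‖v‖ = ‖orbit J hJ v‖ := rfl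

theorem orbit_apply (v : ComplexSpace J hJ) (z : ℂ) :
    orbit J hJ v z = action J hJ z (v : E) :=
  (complexOrbit_apply J v z).trans (action_apply J hJ z v).symm

instance : NormedSpace ℂ (ComplexSpace J hJ) where
  norm_smul_le z v := by
    rw [norm_def, norm_def]
    refine ContinuousLinearMap.opNorm_le_bound _ (by positivity) fun w => ?_
    -- Scaling `v` by `z` precomposes its orbit with multiplication by `z`, which costs a factor
    -- `‖z‖`.
    have h : orbit J hJ (z • v) w = orbit J hJ v (w * z) := by
      rw [orbit_apply, orbit_apply, map_mul, smul_def]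
      rfl
    rw [h]
    refine ((orbit J hJ v).le_opNorm _).trans_eq ?_
    rw [norm_mul]
    ring

/-- The identity, as a real linear homeomorphism. -/
def equiv : E ≃L[ℝ] ComplexSpace J hJ :=
  LinearEquiv.toContinuousLinearEquivOfBounds
    { toFun := ofReal J hJ
      invFun := fun v => (v : E)
      map_add' := (ofReal J hJ).map_add
      map_smul' := fun r v => by
        change (r • v : E) = action J hJ (r : ℂ) v
        simp
      left_inv := fun _ => rfl
      right_inv := fun _ => rfl }
    -- The inverse has bound `1` because evaluating the orbit at `1` recovers `v`.
    ‖complexOrbit J‖ 1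
    (fun v => (complexOrbit J).le_opNorm v)
    (fun v => by
      have h : orbit J hJ v 1 = v := by
        rw [orbit_apply, map_one]
        rfl
      have h' := (orbit J hJ v).le_opNorm 1
      rw [h, norm_one, mul_one] at h'
      rw [one_mul]
      exact h')

theorem equiv_apply_J (v : E) : equiv J hJ (J v) = Complex.I • equiv J hJ v := by
  change J v = action J hJ Complex.I v
  simp [action_apply]

end ComplexSpace

/-- A real Banach space with an operator of square `-1` is, up to an equivalent norm, a complex
Banach space in which this operator is the multiplication by `i`. -/
theorem exists_complex_equiv [CompleteSpace E] (J : E →L[ℝ] E) (hJ : ∀ v, J (J v) = -v) :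
    ∃ (F : Type u) (_ : NormedAddCommGroup F) (_ : NormedSpace ℂ F) (_ : CompleteSpace F)
      (φ : E ≃L[ℝ] F), ∀ v, φ (J v) = Complex.I • φ v :=
  ⟨ComplexSpace J hJ, inferInstance, inferInstance,
    (completeSpace_congr (e := (ComplexSpace.equiv J hJ).toEquiv)
      (ComplexSpace.equiv J hJ).isUniformEmbedding).1 inferInstance,
    ComplexSpace.equiv J hJ, ComplexSpace.equiv_apply_J J hJ⟩

end Complexify

/-! ### Integrability from a chart that makes the almost complex structure constant -/

section Integrable

variable {E : Type u} [NormedAddCommGroup E] [NormedSpace ℝ E] [CompleteSpace E]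
  {M : Type*} [TopologicalSpace M] [ChartedSpace E M] [IsManifold 𝓘(ℝ, E) ∞ M]

/-- A one-chart atlas has no nontrivial transition maps, so holomorphy is automatic once `J` is
multiplication by `i` on the model. -/
theorem TangentBundleMap.isIntegrableComplexStructure_of_chart {𝒥 : TangentBundleMap E M}
    (h𝒥 : 𝒥.IsAlmostComplex) (J : E →L[ℝ] E) (hJ : ∀ v, J (J v) = -v)
    (ψ : OpenPartialHomeomorph M E) (hs : ψ.source = Set.univ)
    (hψ : ContMDiff 𝓘(ℝ, E) 𝓘(ℝ, E) ∞ ψ)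
    (hψ' : ContMDiffOn 𝓘(ℝ, E) 𝓘(ℝ, E) ∞ ψ.symm ψ.target)
    (hd : ∀ p, ∃ d : E →L[ℝ] E, HasMFDerivAt 𝓘(ℝ, E) 𝓘(ℝ, E) ψ p d ∧
      ∀ v : TangentSpace 𝓘(ℝ, E) p, d (𝒥.toFun p v) = J (d v)) :
    𝒥.IsIntegrableComplexStructure := by
  refine ⟨h𝒥, ?_⟩
  obtain ⟨F, iG, iS, iC, φ, hφ⟩ := exists_complex_equiv J hJ
  let e : OpenPartialHomeomorph M F := ψ.transHomeomorph φ.toHomeomorph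
  have he : e.source = Set.univ := hs
  refine ⟨F, iG, iS, iC, e.singletonChartedSpace he, e.isManifold_singleton he, ?_⟩
  intro e' he'
  rw [e.singletonChartedSpace_mem_atlas_eq he e' he']
  refine ⟨?_, ?_, ?_⟩
  · exact (φ.contDiff.contMDiff.comp hψ).contMDiffOn
  · exact hψ'.comp φ.symm.contDiff.contMDiff.contMDiffOn (fun y hy => hy)
  · intro p _
    obtain ⟨d, hd, hdJ⟩ := hd p
    refine ⟨(φ : E →L[ℝ] F).comp d, ?_, fun v => ?_⟩
    · exact HasMFDerivAt.comp p (I' := 𝓘(ℝ, E)) (g := φ)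
        (φ : E →L[ℝ] F).hasFDerivAt.hasMFDerivAt hd
    · exact (congrArg φ (hdJ v)).trans (hφ (d v))

end Integrable

/-! ### Inversion as a change of coordinates -/

section Inverse

variable (R : Type*) [NormedRing R] [CompleteSpace R]

/-- The inversion of the units of a Banach algebra. -/
def ringInversePartialHomeomorph : OpenPartialHomeomorph R R where
  toFun := Ring.inverse
  invFun := Ring.inverse
  source := {x | IsUnit x}
  target := {x | IsUnit x}
  map_source' := fun _ hx => hx.ringInverse
  map_target' := fun _ hx => hx.ringInverse
  left_inv' := by rintro _ ⟨x, rfl⟩; simp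
  right_inv' := by rintro _ ⟨x, rfl⟩; simp
  open_source := Units.isOpen
  open_target := Units.isOpen
  continuousOn_toFun := by
    rintro _ ⟨x, rfl⟩
    exact (NormedRing.inverse_continuousAt x).continuousWithinAt
  continuousOn_invFun := by
    rintro _ ⟨x, rfl⟩
    exact (NormedRing.inverse_continuousAt x).continuousWithinAt

end Inverse

/-! ### The quotient of a C*-algebra by a closed two-sided ideal -/

section QuotientAlgebra

variable {𝔄 : Type u} [CStarAlgebra 𝔄] (𝔨 : Ideal 𝔄)

/-- The global chart `g K ↦ g + 𝔨` of `G ⧸ K`. -/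
def quotientChart : OpenPartialHomeomorph (𝔄ˣ ⧸ onePlusUnits 𝔨) (𝔄 ⧸ 𝔨) :=
  (isOpenEmbedding_quotientEmbedding 𝔨).toOpenPartialHomeomorph _

theorem chartAt_quotientChart (p : 𝔄ˣ ⧸ onePlusUnits 𝔨) :
    chartAt (𝔄 ⧸ 𝔨) p = quotientChart 𝔨 := rfl

theorem quotientChart_source : (quotientChart 𝔨).source = Set.univ := rfl

variable [𝔨.IsTwoSided]

/-- The image in `𝔄 ⧸ 𝔨` of an invertible element. -/
def unitsMk (g : 𝔄ˣ) : (𝔄 ⧸ 𝔨)ˣ := Units.map (Ideal.Quotient.mk 𝔨).toMonoidHom g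

/-- Only this inclusion is available in general: a unit of `𝔄 ⧸ 𝔨` need not lift to a unit of `𝔄`.
-/
theorem exists_unit_quotientChart (p : 𝔄ˣ ⧸ onePlusUnits 𝔨) :
    ∃ x : (𝔄 ⧸ 𝔨)ˣ, quotientChart 𝔨 p = x := by
  induction p using QuotientGroup.induction_on with | _ g
  exact ⟨unitsMk 𝔨 g, rfl⟩

theorem exists_unit_of_mem_target {y : 𝔄 ⧸ 𝔨} (hy : y ∈ (quotientChart 𝔨).target) :
    ∃ x : (𝔄 ⧸ 𝔨)ˣ, y = x := by
  obtain ⟨x, hx⟩ := exists_unit_quotientChart 𝔨 ((quotientChart 𝔨).symm y)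
  exact ⟨x, by rw [← hx, (quotientChart 𝔨).right_inv hy]⟩

theorem quotientChart_smul (g : 𝔄ˣ) (p : 𝔄ˣ ⧸ onePlusUnits 𝔨) :
    quotientChart 𝔨 (g • p) = unitsMk 𝔨 g * quotientChart 𝔨 p := by
  induction p using QuotientGroup.induction_on with | _ h
  rfl

/-- Conjugation by `k` is the restriction of a continuous linear map to the open set of units. -/
theorem lieAd_units_apply (k : 𝔄ˣ) (v : 𝔄) :
    lieAd (E := 𝔄) k v = (k : 𝔄) * v * (↑k⁻¹ : 𝔄) := by
  have he : ∀ x : 𝔄ˣ, chartAt 𝔄 x = Units.isOpenEmbedding_val.toOpenPartialHomeomorph _ :=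
    fun _ => rfl
  have h : HasMFDerivAt 𝓘(ℝ, 𝔄) 𝓘(ℝ, 𝔄) (fun h : 𝔄ˣ => k * h * k⁻¹) 1
      (ContinuousLinearMap.mulLeftRight ℝ 𝔄 k (↑k⁻¹ : 𝔄)) := by
    refine hasMFDerivAt_of_chartAt_eq he he (Continuous.continuousAt (by fun_prop)) ?_
    refine (ContinuousLinearMap.hasFDerivAt _).congr_of_eventuallyEq ?_
    filter_upwards [Units.isOpenEmbedding_val.isOpen_range.mem_nhds ⟨(1 : 𝔄ˣ), rfl⟩]
    rintro _ ⟨a, rfl⟩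
    rw [Topology.IsOpenEmbedding.toOpenPartialHomeomorph_left_inv]
    rfl
  exact congrArg (fun d : 𝔄 →L[ℝ] 𝔄 => d v) h.mfderiv

theorem isAdmissible_leftRightMul (A B : 𝔄) :
    IsAdmissible (onePlusUnits 𝔨) (idealLie 𝔨) (leftRightMul A B) := by
  refine ⟨fun v hv => 𝔨.mul_mem_right B (𝔨.mul_mem_left A hv), fun k hk (v : 𝔄) => ?_⟩
  have h : lieAd (E := 𝔄) k (leftRightMul A B v) - leftRightMul A B (lieAd (E := 𝔄) k v) =
      ((k : 𝔄) * (A * v * B) * (↑k⁻¹ : 𝔄) - A * ((k : 𝔄) * v * (↑k⁻¹ : 𝔄)) * B : 𝔄) := by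
    rw [lieAd_units_apply k v]
    exact congrArg (fun z : 𝔄 => z - A * ((k : 𝔄) * v * (↑k⁻¹ : 𝔄)) * B)
      (lieAd_units_apply k (A * v * B))
  rw [h]
  change _ ∈ 𝔨
  -- Modulo `𝔨` both `k` and `k⁻¹` become `1`, so both terms reduce to the class of `A v B`.
  have h1 : ∀ g ∈ onePlusUnits 𝔨, Ideal.Quotient.mk 𝔨 (g : 𝔄) = 1 := fun g hg => by
    rw [← map_one (Ideal.Quotient.mk 𝔨)]
    exact Ideal.Quotient.eq.2 hg
  rw [← Ideal.Quotient.eq_zero_iff_mem]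
  simp only [map_sub, map_mul, h1 k hk, h1 _ (inv_mem hk), one_mul, mul_one, sub_self]

variable [IsClosed (𝔨 : Set 𝔄)]

/-- The quotient of a C*-algebra by a closed two-sided ideal is a normed ring. -/
abbrev quotientNormedRing : NormedRing (𝔄 ⧸ 𝔨) :=
  { (inferInstance : NormedAddCommGroup (𝔄 ⧸ 𝔨)), (inferInstance : Ring (𝔄 ⧸ 𝔨)) with
    norm_mul_le := by
      intro x y
      -- Representatives with norms within `ε` of the quotient norms bound the product; then `ε →
      -- 0`.
      have hlim : Filter.Tendsto (fun ε : ℝ => (‖x‖ + ε) * (‖y‖ + ε)) (nhdsWithin 0 (Set.Ioi 0))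
          (nhds (‖x‖ * ‖y‖)) := by
        have h : Continuous fun ε : ℝ => (‖x‖ + ε) * (‖y‖ + ε) := by fun_prop
        simpa using (h.tendsto 0).mono_left nhdsWithin_le_nhds
      refine ge_of_tendsto hlim ?_
      filter_upwards [self_mem_nhdsWithin] with ε hε
      obtain ⟨a, rfl, ha⟩ := Submodule.Quotient.norm_mk_lt x (Set.mem_Ioi.1 hε)
      obtain ⟨b, rfl, hb⟩ := Submodule.Quotient.norm_mk_lt y (Set.mem_Ioi.1 hε)
      exact (Submodule.Quotient.norm_mk_le 𝔨 (a * b)).trans ((norm_mul_le a b).trans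
        (mul_le_mul ha.le hb.le (norm_nonneg _) ((norm_nonneg _).trans ha.le))) }

attribute [local instance] quotientNormedRing

/-- The quotient of a C*-algebra by a closed two-sided ideal is a real Banach algebra. -/
abbrev quotientNormedAlgebra : NormedAlgebra ℝ (𝔄 ⧸ 𝔨) :=
  { Submodule.Quotient.normedSpace 𝔨 ℝ, Ideal.Quotient.algebra ℝ with }

attribute [local instance] quotientNormedAlgebra

theorem mfderiv_quotient_smul (g : 𝔄ˣ) (p : 𝔄ˣ ⧸ onePlusUnits 𝔨) :
    mfderiv 𝓘(ℝ, 𝔄 ⧸ 𝔨) 𝓘(ℝ, 𝔄 ⧸ 𝔨) (fun q : 𝔄ˣ ⧸ onePlusUnits 𝔨 => g • q) p =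
      ContinuousLinearMap.mul ℝ (𝔄 ⧸ 𝔨) (unitsMk 𝔨 g : 𝔄 ⧸ 𝔨) := by
  refine (hasMFDerivAt_of_chartAt_eq (chartAt_quotientChart 𝔨) (chartAt_quotientChart 𝔨)
    (continuous_const_smul g).continuousAt ?_).mfderiv
  refine (ContinuousLinearMap.hasFDerivAt _).congr_of_eventuallyEq ?_
  filter_upwards [(quotientChart 𝔨).open_target.mem_nhds
    ((quotientChart 𝔨).map_source (Set.mem_univ p))] with y hy
  rw [quotientChart_smul, (quotientChart 𝔨).right_inv hy]
  rfl

variable {𝔨} {A B : 𝔄} {𝒩 : TangentBundleMap (𝔄 ⧸ 𝔨) (𝔄ˣ ⧸ onePlusUnits 𝔨)}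

/-- The differential of the projection is onto, so the first condition fixes the operator at the
base point. Left translation carries that point to every other, which leaves a single candidate. -/
theorem isInducedBy_leftRightMul_iff :
    𝒩.IsInducedBy (leftRightMul A B) ↔
      ∀ p, 𝒩.toFun p = conjMul (Ideal.Quotient.mk 𝔨 A) (Ideal.Quotient.mk 𝔨 B)
        (quotientChart 𝔨 p) := by
  have h1 : quotientChart 𝔨 ((1 : 𝔄ˣ) : 𝔄ˣ ⧸ onePlusUnits 𝔨) = 1 := rfl
  unfold TangentBundleMap.IsInducedBy
  simp only [(hasMFDerivAt_mk 𝔨 1).mfderiv, mfderiv_quotient_smul]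
  constructor
  · rintro ⟨hN1, hN2⟩ p
    obtain ⟨g, rfl⟩ : ∃ g : 𝔄ˣ, p = g • ((1 : 𝔄ˣ) : 𝔄ˣ ⧸ onePlusUnits 𝔨) := by
      induction p using QuotientGroup.induction_on with | _ g
      exact ⟨g, congrArg _ (mul_one g).symm⟩
    ext (w : 𝔄 ⧸ 𝔨)
    -- A lift of `g⁻¹ w` presents `w` as the translate by `g` of a tangent vector at the base point.
    obtain ⟨v, hv⟩ := Ideal.Quotient.mk_surjective ((↑(unitsMk 𝔨 g)⁻¹ : 𝔄 ⧸ 𝔨) * w)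
    have hw : w = unitsMk 𝔨 g * Ideal.Quotient.mk 𝔨 v := by
      rw [hv, Units.mul_inv_cancel_left]
    have h2 := hN2 g (Ideal.Quotient.mk 𝔨 v)
    have h3 := hN1 v
    rw [hw]
    refine h2.trans ((congrArg (ContinuousLinearMap.mul ℝ (𝔄 ⧸ 𝔨) (unitsMk 𝔨 g : 𝔄 ⧸ 𝔨))
      h3).trans ?_)
    have h4 := conjMul_units_mul_apply (Ideal.Quotient.mk 𝔨 A) (Ideal.Quotient.mk 𝔨 B)
      (unitsMk 𝔨 g) 1 (Ideal.Quotient.mk 𝔨 v)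
    rw [Units.val_one, conjMul_one_apply, ← map_mul, ← map_mul] at h4
    rw [quotientChart_smul, h1]
    exact h4.symm
  · intro h
    simp only [h, h1]
    refine ⟨fun (v : 𝔄) => ?_, fun g (w : 𝔄 ⧸ 𝔨) => ?_⟩
    · refine (conjMul_one_apply _ _ (Ideal.Quotient.mk 𝔨 v)).trans ?_
      rw [← map_mul, ← map_mul]
      rfl
    · rw [quotientChart_smul, h1]
      exact conjMul_units_mul_apply _ _ (unitsMk 𝔨 g) 1 w

theorem contDiffOn_conjMul_quotientChart (a b : 𝔄 ⧸ 𝔨) :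
    ContDiffOn ℝ ∞ (conjMul a b) (quotientChart 𝔨).target := by
  intro y hy
  obtain ⟨x, rfl⟩ := exists_unit_of_mem_target 𝔨 hy
  exact (contDiffAt_conjMul a b x).contDiffWithinAt

variable (𝔨 A B) in
theorem existsUnique_isInducedBy_leftRightMul :
    ∃! 𝒩 : TangentBundleMap (𝔄 ⧸ 𝔨) (𝔄ˣ ⧸ onePlusUnits 𝔨),
      𝒩.IsInducedBy (leftRightMul A B) := by
  refine ⟨TangentBundleMap.ofSingleChart (chartAt_quotientChart 𝔨) (quotientChart_source 𝔨)
    _ (contDiffOn_conjMul_quotientChart (Ideal.Quotient.mk 𝔨 A) (Ideal.Quotient.mk 𝔨 B)),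
    isInducedBy_leftRightMul_iff.2 fun p => rfl, fun 𝒩 h𝒩 => ?_⟩
  exact TangentBundleMap.ext (funext (isInducedBy_leftRightMul_iff.1 h𝒩))

/-! ### Properties of the induced bundle map -/

section Induced

variable (h𝒩 : 𝒩.IsInducedBy (leftRightMul A B))
include h𝒩

theorem TangentBundleMap.IsInducedBy.isHomogeneous : 𝒩.IsHomogeneous := by
  intro g p (v : 𝔄 ⧸ 𝔨)
  rw [isInducedBy_leftRightMul_iff] at h𝒩
  obtain ⟨x, hx⟩ := exists_unit_quotientChart 𝔨 p
  simp only [mfderiv_quotient_smul, h𝒩, quotientChart_smul, hx]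
  exact (conjMul_units_mul_apply _ _ (unitsMk 𝔨 g) x v).symm

theorem TangentBundleMap.IsInducedBy.isAlmostComplex (hA : A ^ 2 ∈ Set.center 𝔄)
    (hAB : A ^ 2 * B ^ 2 = -1) : 𝒩.IsAlmostComplex := by
  intro p (v : 𝔄 ⧸ 𝔨)
  rw [isInducedBy_leftRightMul_iff] at h𝒩
  rw [h𝒩]
  obtain ⟨x, hx⟩ := exists_unit_quotientChart 𝔨 p
  -- Centrality of `A²` descends because the quotient map is surjective.
  have hc : ∀ y : 𝔄 ⧸ 𝔨, Ideal.Quotient.mk 𝔨 A * (Ideal.Quotient.mk 𝔨 A * y) =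
      y * Ideal.Quotient.mk 𝔨 A * Ideal.Quotient.mk 𝔨 A := by
    intro y
    obtain ⟨y, rfl⟩ := Ideal.Quotient.mk_surjective y
    have h := hA.comm y
    rw [commute_iff_eq, pow_two] at h
    rw [← mul_assoc, mul_assoc (Ideal.Quotient.mk 𝔨 y)]
    simp only [← map_mul, h]
  have hB : Ideal.Quotient.mk 𝔨 A * (Ideal.Quotient.mk 𝔨 A *
      (Ideal.Quotient.mk 𝔨 B * Ideal.Quotient.mk 𝔨 B)) = -1 := by
    have h := congrArg (Ideal.Quotient.mk 𝔨) hAB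
    simpa [pow_two, mul_assoc] using h
  change conjMul _ _ (quotientChart 𝔨 p) (conjMul _ _ (quotientChart 𝔨 p) v) = -v
  rw [hx, conjMul_apply, conjMul_apply, Ring.inverse_unit]
  generalize Ideal.Quotient.mk 𝔨 A = a at *
  generalize Ideal.Quotient.mk 𝔨 B = b at *
  have h1 : (x : 𝔄 ⧸ 𝔨) * a * ↑x⁻¹ * (x * a * ↑x⁻¹ * v * b) * b =
      x * (a * (a * (↑x⁻¹ * v))) * b * b := by
    simp only [mul_assoc, Units.inv_mul_cancel_left]
  rw [h1, hc]
  have h2 : (x : 𝔄 ⧸ 𝔨) * (↑x⁻¹ * v * a * a) * b * b = v * (a * (a * (b * b))) := by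
    simp only [mul_assoc, Units.mul_inv_cancel_left]
  rw [h2, hB, mul_neg_one]

theorem TangentBundleMap.IsInducedBy.isNijenhuis
    (h : A = 1 ∨ B = 1 ∨ ∀ x y : 𝔄, x * y = y * x) : 𝒩.IsNijenhuis := by
  intro X Y hX hY p
  rw [isInducedBy_leftRightMul_iff] at h𝒩
  have he := chartAt_quotientChart 𝔨
  have hs := quotientChart_source 𝔨
  have hp : quotientChart 𝔨 p ∈ (quotientChart 𝔨).target :=
    (quotientChart 𝔨).map_source (Set.mem_univ p)
  have hnhds := (quotientChart 𝔨).open_target.mem_nhds hp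
  have hdiff : ∀ {Z : ∀ p : 𝔄ˣ ⧸ onePlusUnits 𝔨, TangentSpace 𝓘(ℝ, 𝔄 ⧸ 𝔨) p},
      IsSmoothVectorField Z →
      DifferentiableAt ℝ (vectorFieldCoord (quotientChart 𝔨) Z) (quotientChart 𝔨 p) := fun hZ =>
    ((hZ.contDiffOn_singleChart he).contDiffAt hnhds).differentiableAt (by simp)
  -- Off the target the inverse chart carries no information, so the coordinate formula is asserted
  -- only for germs.
  have hfield : ∀ Z : ∀ p : 𝔄ˣ ⧸ onePlusUnits 𝔨, TangentSpace 𝓘(ℝ, 𝔄 ⧸ 𝔨) p,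
      vectorFieldCoord (quotientChart 𝔨) (𝒩.onField Z) =ᶠ[nhds (quotientChart 𝔨 p)]
        fun y => conjMul (Ideal.Quotient.mk 𝔨 A) (Ideal.Quotient.mk 𝔨 B) y
          (vectorFieldCoord (quotientChart 𝔨) Z y) := by
    intro Z
    filter_upwards [hnhds] with y hy
    change 𝒩.toFun ((quotientChart 𝔨).symm y) (Z ((quotientChart 𝔨).symm y)) = _
    rw [h𝒩, (quotientChart 𝔨).right_inv hy]
    rfl
  have h' : Ideal.Quotient.mk 𝔨 A = 1 ∨ Ideal.Quotient.mk 𝔨 B = 1 ∨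
      ∀ x y : 𝔄 ⧸ 𝔨, x * y = y * x := by
    rcases h with rfl | rfl | h
    · exact Or.inl (map_one _)
    · exact Or.inr (Or.inl (map_one _))
    · refine Or.inr (Or.inr fun x y => ?_)
      obtain ⟨x, rfl⟩ := Ideal.Quotient.mk_surjective x
      obtain ⟨y, rfl⟩ := Ideal.Quotient.mk_surjective y
      rw [← map_mul, h, map_mul]
  obtain ⟨x, hx⟩ := exists_unit_quotientChart 𝔨 p
  have key := conjMul_torsion_eq_zero _ _ h' x (hx ▸ hdiff hX) (hx ▸ hdiff hY)
  unfold TangentBundleMap.torsion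
  rw [mlieBracket_singleChart he hs, mlieBracket_singleChart he hs, mlieBracket_singleChart he hs,
    mlieBracket_singleChart he hs, h𝒩,
    (hfield X).lieBracket_vectorField_eq Filter.EventuallyEq.rfl,
    (hfield X).lieBracket_vectorField_eq (hfield Y),
    Filter.EventuallyEq.rfl.lieBracket_vectorField_eq (hfield Y), hx]
  exact key

/-- For `A = 1` the field is constant in the given chart; for `B = 1` it becomes constant after
inversion. -/
theorem TangentBundleMap.IsInducedBy.isIntegrableComplexStructure (hAB : A = 1 ∨ B = 1)
    (hac : 𝒩.IsAlmostComplex) : 𝒩.IsIntegrableComplexStructure := by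
  rw [isInducedBy_leftRightMul_iff] at h𝒩
  have he := chartAt_quotientChart 𝔨
  have hs := quotientChart_source 𝔨
  let J : 𝔄 ⧸ 𝔨 →L[ℝ] 𝔄 ⧸ 𝔨 := conjMul (Ideal.Quotient.mk 𝔨 A) (Ideal.Quotient.mk 𝔨 B) 1
  -- `J` is the operator at the base point, whose coordinate is `1`.
  have hJ : ∀ v, J (J v) = -v := fun v => by
    have h := hac ((1 : 𝔄ˣ) : 𝔄ˣ ⧸ onePlusUnits 𝔨) v
    rw [h𝒩] at h
    exact h
  rcases hAB with rfl | rfl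
  · refine isIntegrableComplexStructure_of_chart hac J hJ (quotientChart 𝔨) hs
      (contMDiff_singleChart he hs) (contMDiffOn_singleChart_symm he) fun p =>
      ⟨_, hasMFDerivAt_singleChart he hs p, fun v => ?_⟩
    obtain ⟨x, hx⟩ := exists_unit_quotientChart 𝔨 p
    have h : conjMul (Ideal.Quotient.mk 𝔨 1) (Ideal.Quotient.mk 𝔨 B) (x : 𝔄 ⧸ 𝔨) = J := by
      simp only [J, map_one, conjMul_one_left]
    rw [h𝒩, hx, h]
    rfl
  · have hunits : ∀ p, IsUnit (quotientChart 𝔨 p) := fun p => by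
      obtain ⟨x, hx⟩ := exists_unit_quotientChart 𝔨 p
      exact hx ▸ x.isUnit
    have hinv : ∀ x : (𝔄 ⧸ 𝔨)ˣ,
        ContMDiffAt 𝓘(ℝ, 𝔄 ⧸ 𝔨) 𝓘(ℝ, 𝔄 ⧸ 𝔨) ∞ Ring.inverse (x : 𝔄 ⧸ 𝔨) := fun x =>
      (contDiffAt_ringInverse ℝ x).contMDiffAt
    refine isIntegrableComplexStructure_of_chart hac J hJ
      ((quotientChart 𝔨).trans (ringInversePartialHomeomorph _)) ?_ ?_ ?_ fun p => ?_
    · rw [OpenPartialHomeomorph.trans_source, hs, Set.univ_inter]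
      exact Set.eq_univ_of_forall hunits
    · intro p
      obtain ⟨x, hx⟩ := exists_unit_quotientChart 𝔨 p
      exact (hx ▸ hinv x : ContMDiffAt 𝓘(ℝ, 𝔄 ⧸ 𝔨) 𝓘(ℝ, 𝔄 ⧸ 𝔨) ∞ Ring.inverse
        (quotientChart 𝔨 p)).comp p (contMDiff_singleChart he hs p)
    · rw [OpenPartialHomeomorph.trans_target]
      refine (contMDiffOn_singleChart_symm he).comp (t := (quotientChart 𝔨).target) ?_
        fun y hy => hy.2
      rintro _ ⟨⟨x, rfl⟩, -⟩
      exact (hinv x).contMDiffWithinAt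
    · obtain ⟨x, hx⟩ := exists_unit_quotientChart 𝔨 p
      have hd := hasFDerivAt_ringInverse (𝕜 := ℝ) x
      rw [← hx] at hd
      refine ⟨_, HasMFDerivAt.comp p (I' := 𝓘(ℝ, 𝔄 ⧸ 𝔨)) (g := Ring.inverse)
        hd.hasMFDerivAt (hasMFDerivAt_singleChart he hs p),
        fun v => ?_⟩
      -- The outer expression `-(x⁻¹ · x⁻¹)` is the derivative of inversion at `x`; it intertwines
      -- the field with `J`.
      have h : ∀ w : 𝔄 ⧸ 𝔨, -(↑x⁻¹ * conjMul (Ideal.Quotient.mk 𝔨 A) (Ideal.Quotient.mk 𝔨 1)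
          (x : 𝔄 ⧸ 𝔨) w * ↑x⁻¹) = J (-(↑x⁻¹ * w * ↑x⁻¹)) := fun w => by
        simp only [J, map_one, inv_mul_conjMul_mul_inv, map_neg]
      rw [h𝒩, hx]
      exact h v

end Induced

end QuotientAlgebra

end

theorem mainTheorem6 {𝔄 : Type*} [CStarAlgebra 𝔄] (𝔨 : Ideal 𝔄) [𝔨.IsTwoSided]
    [IsClosed (𝔨 : Set 𝔄)] (A B : 𝔄) :
    IsAdmissible (onePlusUnits 𝔨) (idealLie 𝔨) (leftRightMul A B) ∧
    (∃! 𝒩 : TangentBundleMap (𝔄 ⧸ 𝔨) (𝔄ˣ ⧸ onePlusUnits 𝔨),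
      𝒩.IsInducedBy (leftRightMul A B)) ∧
    ∀ 𝒩 : TangentBundleMap (𝔄 ⧸ 𝔨) (𝔄ˣ ⧸ onePlusUnits 𝔨),
      𝒩.IsInducedBy (leftRightMul A B) →
        𝒩.IsHomogeneous ∧
        (A ^ 2 ∈ Set.center 𝔄 → B ^ 2 ∈ Set.center 𝔄 → A ^ 2 * B ^ 2 = -1 →
          𝒩.IsAlmostComplex) ∧
        ((∀ x y : 𝔄, x * y = y * x) → 𝒩.IsNijenhuis) ∧
        (A = 1 ∨ B = 1 →
          𝒩.IsNijenhuis ∧ (𝒩.IsAlmostComplex → 𝒩.IsIntegrableComplexStructure)) := by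
  refine ⟨isAdmissible_leftRightMul 𝔨 A B, existsUnique_isInducedBy_leftRightMul 𝔨 A B,
    fun 𝒩 h𝒩 => ⟨h𝒩.isHomogeneous, fun hA _ hAB => h𝒩.isAlmostComplex hA hAB,
      fun h => h𝒩.isNijenhuis (Or.inr (Or.inr h)),
      fun h => ⟨h𝒩.isNijenhuis ?_, h𝒩.isIntegrableComplexStructure h⟩⟩⟩
  exact h.imp_right Or.inl
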